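/- Let $\mathfrak g$ be a finite-dimensional real Lie algebra, nilpotent of step exactly two (so non-abelian), equipped with an inner product, and let $\mathfrak g=\mathfrak b\oplus\mathfrak z$ be the orthogonal decomposition in which $\mathfrak z$ is the center of $\mathfrak g$. For $\omega\in\mathfrak z^\ast$ put $B_\omega(X,Y)=\omega([X,Y])$ for $X,Y\in\mathfrak b$, let $r_\omega=\{X\in\mathfrak b: B_\omega(X,Y)=0 \text{ for all } Y\in\mathfrak b\}$, and let $m_\omega$ be the orthogonal complement of $r_\omega$ in $\mathfrak b$. Assume that the connected, simply connected Lie group $G$ with Lie algebra $\mathfrak g$ is a Métivier group, i.e. $r_\omega=\{0\}$ for every $\omega\neq 0$. Let $\omega\in\Lambda=\{\omega\in\mathfrak z^\ast:\dim m_\omega \text{ is maximal}\}$, and let $X_1,\dots,X_n,Y_1,\dots,Y_n$ be any orthonormal basis of $\mathfrak b$ for which there are $d_1,\dots,d_n>0$ with $\omega([X_i,Y_j])=\delta_{ij}d_i$ and $\omega([X_i,X_j])=\omega([Y_i,Y_j])=0$ for all $i,j$. Identify $\eta_\omega=\operatorname{span}\{Y_1,\dots,Y_n\}$ with $\mathbb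 R^n$ through the basis $Y_1,\dots,Y_n$. For $v=\sum_j x_jX_j+\sum_j y_jY_j\in\mathfrak b$, let $\pi_\omega(v)$ be the operator on $L^2(\eta_\omega)$ given by \[(\pi_\omega(v)\phi)(\xi)=e^{\,i\sum_{j=1}^n d_j\left(x_j\xi_j+\frac12x_jy_j\right)}\phi(\xi+y),\] and for $h\in L^1\cap L^2(\mathfrak b)$, with respect to Lebesgue measure $dv$ on $\mathfrak b$, let the Weyl transform of $h$ be the bounded operator \[W_\omega(h)=\int_{\mathfrak b}h(v)\,\pi_\omega(v)\,dv\] on $L^2(\eta_\omega)$, where the integral is taken in the strong sense. Let $h\in L^1\cap L^2(\mathfrak b)$ be supported on a compact set $\Sigma\subset\mathfrak b$. If $W_\omega(h)$ is a finite rank operator, then $h=0$ almost everywhere. -/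

import Mathlib

open MeasureTheory Filter Topology
open scoped ENNReal

noncomputable section

/-- A Lie ring with a norm; both structures share one addition. -/
class NormedLieRing (𝔤 : Type*) extends NormedAddCommGroup 𝔤, LieRing 𝔤

/-- A real Lie algebra endowed with an inner product. No compatibility between the bracket and the
inner product is required, only that they live on the same real vector space. -/
class InnerProductLieAlgebra (𝔤 : Type*) [NormedLieRing 𝔤] extends
  InnerProductSpace ℝ 𝔤, LieAlgebra ℝ 𝔤

/-- The Lie algebra is nilpotent of step exactly two (in particular it is not abelian). -/
class IsStepTwo (𝔤 : Type*) [LieRing 𝔤] : Prop where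
  length_eq : LieModule.nilpotencyLength 𝔤 𝔤 = 2

/-- Lebesgue measure of a finite-dimensional real inner product space (a cube spanned by an
orthonormal basis has measure one). The name makes sure that on a subspace the measure is the
one of the subspace itself, and not the restriction of the measure of the ambient space. -/
def lebesgue (E : Type*) [NormedAddCommGroup E] [InnerProductSpace ℝ E] [FiniteDimensional ℝ E]
    [MeasurableSpace E] [BorelSpace E] : Measure E := volume

namespace Metivier

section Algebra

variable (𝔤 : Type*) [NormedLieRing 𝔤] [InnerProductLieAlgebra 𝔤]

/-- The center `𝔷` of the Lie algebra, as a linear subspace. -/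
abbrev centerSpace : Submodule ℝ 𝔤 := (LieAlgebra.center ℝ 𝔤).toSubmodule

/-- The orthogonal complement `𝔟` of the center. -/
abbrev horizontal : Submodule ℝ 𝔤 := (centerSpace 𝔤)ᗮ

variable {𝔤}

theorem lie_mem_center [IsStepTwo 𝔤] (x y : 𝔤) : ⁅x, y⁆ ∈ centerSpace 𝔤 := by
  have h2 := ((LieModule.nilpotencyLength_eq_succ_iff (R := ℝ) (L := 𝔤) (M := 𝔤) 1).1
    (IsStepTwo.length_eq (𝔤 := 𝔤))).1
  change ⁅x, y⁆ ∈ LieAlgebra.center ℝ 𝔤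
  rw [LieModule.mem_maxTrivSubmodule]
  intro z
  have hz : ⁅z, ⁅x, y⁆⁆ ∈ LieModule.lowerCentralSeries ℝ 𝔤 𝔤 2 := by
    rw [LieModule.lowerCentralSeries_succ, LieModule.lowerCentralSeries_succ,
      LieModule.lowerCentralSeries_zero]
    exact LieSubmodule.lie_mem_lie (LieSubmodule.mem_top z)
      (LieSubmodule.lie_mem_lie (LieSubmodule.mem_top x) (LieSubmodule.mem_top y))
  have h3 : LieModule.lowerCentralSeries ℝ 𝔤 𝔤 2 = ⊥ := h2
  rw [h3] at hz
  simpa using hz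

/-- The bilinear form `B_ω(X, Y) = ω([X, Y])` on `𝔟`, for a linear functional `ω` on the
center. -/
def form [IsStepTwo 𝔤] (ω : Module.Dual ℝ (centerSpace 𝔤)) (X Y : horizontal 𝔤) : ℝ :=
  ω ⟨⁅(X : 𝔤), (Y : 𝔤)⁆, lie_mem_center _ _⟩

/-- The radical `r_ω = {X ∈ 𝔟 : B_ω(X, Y) = 0 for all Y ∈ 𝔟}`. -/
def radical [IsStepTwo 𝔤] (ω : Module.Dual ℝ (centerSpace 𝔤)) :
    Submodule ℝ (horizontal 𝔤) where
  carrier := {X | ∀ Y, form ω X Y = 0}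
  zero_mem' := fun Y => by
    have : (⟨⁅((0 : horizontal 𝔤) : 𝔤), (Y : 𝔤)⁆, lie_mem_center _ _⟩ : centerSpace 𝔤) = 0 :=
      Subtype.ext (by simp)
    change ω _ = 0
    rw [this, map_zero]
  add_mem' := fun {X X'} hX hX' Y => by
    have e : (⟨⁅((X + X' : horizontal 𝔤) : 𝔤), (Y : 𝔤)⁆, lie_mem_center _ _⟩ : centerSpace 𝔤)
        = ⟨⁅(X : 𝔤), (Y : 𝔤)⁆, lie_mem_center _ _⟩ + ⟨⁅(X' : 𝔤), (Y : 𝔤)⁆, lie_mem_center _ _⟩ :=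
      Subtype.ext (by simp)
    have h1 := hX Y
    have h2 := hX' Y
    unfold form at *
    rw [e, map_add, h1, h2, add_zero]
  smul_mem' := fun c X hX Y => by
    have e : (⟨⁅((c • X : horizontal 𝔤) : 𝔤), (Y : 𝔤)⁆, lie_mem_center _ _⟩ : centerSpace 𝔤)
        = c • ⟨⁅(X : 𝔤), (Y : 𝔤)⁆, lie_mem_center _ _⟩ :=
      Subtype.ext (by simp)
    have h1 := hX Y
    unfold form at *
    rw [e, map_smul, h1, smul_zero]

variable (𝔤) in
/-- The step two algebra is the Lie algebra of a Métivier group: `B_ω` is non-degenerate for every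
`ω ≠ 0`. -/
def IsMetivier [IsStepTwo 𝔤] : Prop :=
  ∀ ω : Module.Dual ℝ (centerSpace 𝔤), ω ≠ 0 → radical ω = ⊥

variable (𝔤) in
/-- The set `Λ` of the functionals `ω` on the center for which the dimension of `m_ω`, the
orthogonal complement of `r_ω` in `𝔟`, is maximal. -/
def maximalSet [IsStepTwo 𝔤] : Set (Module.Dual ℝ (centerSpace 𝔤)) :=
  {ω | ∀ ω' : Module.Dual ℝ (centerSpace 𝔤),
    Module.finrank ℝ ((radical ω')ᗮ : Submodule ℝ (horizontal 𝔤)) ≤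
      Module.finrank ℝ ((radical ω)ᗮ : Submodule ℝ (horizontal 𝔤))}

/-- An orthonormal almost symplectic basis of `𝔟` for `ω`: an orthonormal basis
`X_1, …, X_n, Y_1, …, Y_n` together with numbers `d_i > 0` such that `ω[X_i, Y_j] = δ_ij d_i`
and `ω[X_i, X_j] = ω[Y_i, Y_j] = 0`. -/
structure AlmostSymplecticBasis [IsStepTwo 𝔤] (ω : Module.Dual ℝ (centerSpace 𝔤)) (n : ℕ) where
  /-- `X_i` has the index `Sum.inl i`, and `Y_j` has the index `Sum.inr j`. -/
  basis : OrthonormalBasis (Fin n ⊕ Fin n) ℝ (horizontal 𝔤)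
  d : Fin n → ℝ
  d_pos : ∀ i, 0 < d i
  form_X_Y : ∀ i j, form ω (basis (Sum.inl i)) (basis (Sum.inr j)) = if i = j then d i else 0
  form_X_X : ∀ i j, form ω (basis (Sum.inl i)) (basis (Sum.inl j)) = 0
  form_Y_Y : ∀ i j, form ω (basis (Sum.inr i)) (basis (Sum.inr j)) = 0

end Algebra

/-- The space `L²(η_ω)`, where `η_ω = span {Y_1, …, Y_n}` is identified with `ℝⁿ` by the
orthonormal basis `Y_1, …, Y_n`. -/
abbrev L2 (n : ℕ) := Lp ℂ 2 (volume : Measure (EuclideanSpace ℝ (Fin n)))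

namespace AlmostSymplecticBasis

variable {𝔤 : Type*} [NormedLieRing 𝔤] [InnerProductLieAlgebra 𝔤] [IsStepTwo 𝔤]
  {ω : Module.Dual ℝ (centerSpace 𝔤)} {n : ℕ} (S : AlmostSymplecticBasis ω n)

/-- The coordinates `x_j` of `v = ∑ x_j X_j + ∑ y_j Y_j`. -/
def x (v : horizontal 𝔤) : EuclideanSpace ℝ (Fin n) :=
  WithLp.toLp 2 fun j => S.basis.repr v (Sum.inl j)

/-- The coordinates `y_j` of `v = ∑ x_j X_j + ∑ y_j Y_j`. -/
def y (v : horizontal 𝔤) : EuclideanSpace ℝ (Fin n) :=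
  WithLp.toLp 2 fun j => S.basis.repr v (Sum.inr j)

/-- The phase `exp (i ∑ d_j (x_j ξ_j + x_j y_j / 2))`. -/
def phase (v : horizontal 𝔤) (ξ : EuclideanSpace ℝ (Fin n)) : ℂ :=
  Complex.exp (Complex.I *
    ((∑ j, S.d j * (S.x v j * ξ j + 1 / 2 * (S.x v j * S.y v j)) : ℝ) : ℂ))

/-- The function `ξ ↦ exp (i ∑ d_j (x_j ξ_j + x_j y_j / 2)) φ(ξ + y)`. -/
def repFun (v : horizontal 𝔤) (φ : EuclideanSpace ℝ (Fin n) → ℂ) :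
    EuclideanSpace ℝ (Fin n) → ℂ :=
  fun ξ => S.phase v ξ * φ (ξ + S.y v)

theorem norm_phase (v : horizontal 𝔤) (ξ : EuclideanSpace ℝ (Fin n)) : ‖S.phase v ξ‖ = 1 := by
  unfold phase
  rw [mul_comm, Complex.norm_exp_ofReal_mul_I]

@[fun_prop]
theorem continuous_x : Continuous S.x := by
  unfold x
  fun_prop

@[fun_prop]
theorem continuous_y : Continuous S.y := by
  unfold y
  fun_prop

theorem continuous_phase (v : horizontal 𝔤) : Continuous (S.phase v) := by
  unfold phase
  fun_prop

theorem continuous_phase_left (ξ : EuclideanSpace ℝ (Fin n)) :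
    Continuous fun v => S.phase v ξ := by
  have hx : ∀ j, Continuous fun v => S.x v j := fun j =>
    (EuclideanSpace.proj (𝕜 := ℝ) j).continuous.comp S.continuous_x
  have hy : ∀ j, Continuous fun v => S.y v j := fun j =>
    (EuclideanSpace.proj (𝕜 := ℝ) j).continuous.comp S.continuous_y
  unfold phase
  fun_prop

theorem measurePreserving_shift (v : horizontal 𝔤) :
    MeasurePreserving (fun ξ : EuclideanSpace ℝ (Fin n) => ξ + S.y v) volume volume :=
  measurePreserving_add_right volume (S.y v)

theorem eLpNorm_repFun (v : horizontal 𝔤) {φ : EuclideanSpace ℝ (Fin n) → ℂ}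
    (hφ : AEStronglyMeasurable φ volume) :
    eLpNorm (S.repFun v φ) 2 volume = eLpNorm φ 2 volume := by
  rw [← eLpNorm_comp_measurePreserving hφ (S.measurePreserving_shift v)]
  refine eLpNorm_congr_norm_ae (ae_of_all _ fun ξ => ?_)
  simp [repFun, norm_phase]

theorem memLp_repFun (v : horizontal 𝔤) {φ : EuclideanSpace ℝ (Fin n) → ℂ}
    (hφ : MemLp φ 2 volume) : MemLp (S.repFun v φ) 2 volume := by
  refine ⟨?_, ?_⟩
  · exact (S.continuous_phase v).aestronglyMeasurable.mul
      (hφ.1.comp_measurePreserving (S.measurePreserving_shift v))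
  · rw [S.eLpNorm_repFun v hφ.1]
    exact hφ.2

theorem repFun_congr (v : horizontal 𝔤) {φ ψ : EuclideanSpace ℝ (Fin n) → ℂ}
    (h : φ =ᵐ[volume] ψ) : S.repFun v φ =ᵐ[volume] S.repFun v ψ := by
  filter_upwards [(S.measurePreserving_shift v).quasiMeasurePreserving.ae_eq_comp h] with ξ hξ
  simp only [Function.comp] at hξ
  simp [repFun, hξ]

/-- The class in `L²(η_ω)` of the function `repFun`. -/
def repLp (v : horizontal 𝔤) (φ : L2 n) : L2 n :=
  MemLp.toLp (S.repFun v φ) (S.memLp_repFun v (Lp.memLp φ))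

theorem coeFn_repLp (v : horizontal 𝔤) (φ : L2 n) :
    S.repLp v φ =ᵐ[volume] S.repFun v φ :=
  MemLp.coeFn_toLp _

theorem repLp_add (v : horizontal 𝔤) (φ ψ : L2 n) :
    S.repLp v (φ + ψ) = S.repLp v φ + S.repLp v ψ := by
  apply Lp.ext
  filter_upwards [S.coeFn_repLp v (φ + ψ), S.repFun_congr v (Lp.coeFn_add φ ψ),
    Lp.coeFn_add (S.repLp v φ) (S.repLp v ψ), S.coeFn_repLp v φ,
    S.coeFn_repLp v ψ] with ξ e0 e1 e2 e3 e4
  rw [e0, e1, e2, Pi.add_apply, e3, e4]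
  simp only [repFun, Pi.add_apply, mul_add]

theorem repLp_smul (v : horizontal 𝔤) (c : ℂ) (φ : L2 n) :
    S.repLp v (c • φ) = c • S.repLp v φ := by
  apply Lp.ext
  filter_upwards [S.coeFn_repLp v (c • φ), S.repFun_congr v (Lp.coeFn_smul c φ),
    Lp.coeFn_smul c (S.repLp v φ), S.coeFn_repLp v φ] with ξ e0 e1 e2 e3
  rw [e0, e1, e2, Pi.smul_apply, e3]
  simp only [repFun, Pi.smul_apply, smul_eq_mul]
  ring

theorem norm_repLp (v : horizontal 𝔤) (φ : L2 n) : ‖S.repLp v φ‖ = ‖φ‖ := by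
  rw [repLp, Lp.norm_toLp, S.eLpNorm_repFun v (Lp.memLp φ).1, ← Lp.norm_def]

/-- The isometric operator `π_ω(v)` on `L²(η_ω)`:
`(π_ω(v) φ)(ξ) = exp (i ∑ d_j (x_j ξ_j + x_j y_j / 2)) φ(ξ + y)` for `v = (x, y) ∈ 𝔟`. -/
def rep (v : horizontal 𝔤) : L2 n →ₗᵢ[ℂ] L2 n where
  toFun := S.repLp v
  map_add' := S.repLp_add v
  map_smul' := S.repLp_smul v
  norm_map' := S.norm_repLp v

theorem coeFn_rep (v : horizontal 𝔤) (φ : L2 n) :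
    S.rep v φ =ᵐ[volume] fun ξ => S.phase v ξ * φ (ξ + S.y v) :=
  S.coeFn_repLp v φ

/-- Strong continuity of `v ↦ π_ω(v)`. -/
theorem continuous_rep (φ : L2 n) : Continuous fun v => S.rep v φ := by
  rw [continuous_iff_continuousAt]
  intro v₀
  have hshift : Continuous fun v : horizontal 𝔤 =>
      (⟨fun ξ => ξ + S.y v, by fun_prop⟩ : C(EuclideanSpace ℝ (Fin n), EuclideanSpace ℝ (Fin n))) :=
    ContinuousMap.continuous_of_continuous_uncurry _ (by
      change Continuous fun p : horizontal 𝔤 × EuclideanSpace ℝ (Fin n) => p.2 + S.y p.1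
      fun_prop)
  have hT := (continuous_const (y := φ)).compMeasurePreservingLp hshift
    S.measurePreserving_shift (by simp)
  set T : horizontal 𝔤 → L2 n := fun v =>
    Lp.compMeasurePreserving (fun ξ => ξ + S.y v) (S.measurePreserving_shift v) φ with hTdef
  replace hT : Continuous T := hT
  have hT0 : Tendsto (fun v => eLpNorm (⇑(T v) - ⇑(T v₀)) 2 volume) (𝓝 v₀) (𝓝 0) :=
    (Lp.tendsto_Lp_iff_tendsto_eLpNorm' _ _).1 hT.continuousAt
  have hph := S.continuous_phase_left
  have hph' := S.continuous_phase
  have hB : Tendsto (fun v => eLpNorm (fun ξ => (S.phase v ξ - S.phase v₀ ξ) * T v₀ ξ) 2 volume)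
      (𝓝 v₀) (𝓝 0) := by
    have hL : Tendsto (fun v => ∫⁻ ξ, ‖(S.phase v ξ - S.phase v₀ ξ) * T v₀ ξ‖ₑ ^ (2 : ℝ))
        (𝓝 v₀) (𝓝 (∫⁻ _ : EuclideanSpace ℝ (Fin n), 0)) := by
      refine tendsto_lintegral_filter_of_dominated_convergence
        (fun ξ => (‖(2 : ℂ)‖ₑ * ‖T v₀ ξ‖ₑ) ^ (2 : ℝ)) ?_ ?_ ?_ ?_
      · refine Eventually.of_forall fun v => ?_
        exact ((((hph' v).sub (hph' v₀)).measurable.mul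
          (Lp.stronglyMeasurable _).measurable).enorm).pow_const _
      · refine Eventually.of_forall fun v => ae_of_all _ fun ξ => ?_
        refine ENNReal.rpow_le_rpow ?_ (by norm_num)
        rw [enorm_mul]
        gcongr
        rw [enorm_le_iff_norm_le]
        refine (norm_sub_le _ _).trans ?_
        simp only [norm_phase]
        norm_num
      · have h2 := (Lp.memLp (T v₀)).const_mul 2
        have h3 := lintegral_rpow_enorm_lt_top_of_eLpNorm_lt_top (by simp) (by simp) h2.2
        simpa [enorm_mul] using h3.ne
      · refine ae_of_all _ fun ξ => ?_
        have h4 : Continuous fun v => ‖(S.phase v ξ - S.phase v₀ ξ) * T v₀ ξ‖ₑ ^ (2 : ℝ) := by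
          refine ENNReal.continuous_rpow_const.comp (continuous_enorm.comp ?_)
          exact ((hph ξ).sub continuous_const).mul continuous_const
        simpa using h4.tendsto v₀
    have h5 : ∀ v, eLpNorm (fun ξ => (S.phase v ξ - S.phase v₀ ξ) * T v₀ ξ) 2 volume
        = (∫⁻ ξ, ‖(S.phase v ξ - S.phase v₀ ξ) * T v₀ ξ‖ₑ ^ (2 : ℝ)) ^ (1 / 2 : ℝ) := fun v => by
      rw [eLpNorm_eq_lintegral_rpow_enorm_toReal (by simp) (by simp)]
      simp
    simp only [h5]
    simpa using hL.ennrpow_const (1 / 2 : ℝ)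
  refine (Lp.tendsto_Lp_iff_tendsto_eLpNorm' _ _).2 ?_
  refine tendsto_of_tendsto_of_tendsto_of_le_of_le tendsto_const_nhds
    (by simpa using hT0.add hB) (fun _ => zero_le) (fun v => ?_)
  have hTv : ∀ v, T v =ᵐ[volume] fun ξ => φ (ξ + S.y v) := fun v =>
    Lp.coeFn_compMeasurePreserving φ (S.measurePreserving_shift v)
  have e1 : (⇑(S.rep v φ) - ⇑(S.rep v₀ φ) : EuclideanSpace ℝ (Fin n) → ℂ) =ᵐ[volume]
      (fun ξ => S.phase v ξ * (T v ξ - T v₀ ξ))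
        + fun ξ => (S.phase v ξ - S.phase v₀ ξ) * T v₀ ξ := by
    filter_upwards [S.coeFn_rep v φ, S.coeFn_rep v₀ φ, hTv v, hTv v₀] with ξ a b c d
    simp only [Pi.sub_apply, Pi.add_apply, a, b, c, d]
    ring
  have e2 : eLpNorm (fun ξ => S.phase v ξ * (T v ξ - T v₀ ξ)) 2 volume
      = eLpNorm (⇑(T v) - ⇑(T v₀)) 2 volume :=
    eLpNorm_congr_norm_ae (ae_of_all _ fun ξ => by simp [norm_phase])
  rw [eLpNorm_congr_ae e1, ← e2]
  refine eLpNorm_add_le ?_ ?_ (by norm_num)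
  · exact (hph' v).aestronglyMeasurable.mul
      ((Lp.aestronglyMeasurable _).sub (Lp.aestronglyMeasurable _))
  · exact ((hph' v).sub (hph' v₀)).aestronglyMeasurable.mul (Lp.aestronglyMeasurable _)

variable [FiniteDimensional ℝ 𝔤] [MeasurableSpace 𝔤] [BorelSpace 𝔤]

theorem integrable_smul_rep {h : horizontal 𝔤 → ℂ} (hh : Integrable h (lebesgue (horizontal 𝔤)))
    (φ : L2 n) : Integrable (fun v => h v • S.rep v φ) (lebesgue (horizontal 𝔤)) := by
  refine (hh.norm.mul_const ‖φ‖).mono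
    (hh.1.smul (S.continuous_rep φ).aestronglyMeasurable) (ae_of_all _ fun v => ?_)
  simp [norm_smul]

/-- The Weyl transform `W_ω(h) = ∫_𝔟 h(v) π_ω(v) dv` of an integrable function `h` on `𝔟`, a
bounded operator on `L²(η_ω)`. The integral of operators is taken in the strong sense, that is
`W_ω(h) φ` is the Bochner integral `∫_𝔟 h(v) π_ω(v)φ dv` in `L²(η_ω)`. -/
def weylTransform (h : horizontal 𝔤 → ℂ) (hh : Integrable h (lebesgue (horizontal 𝔤))) :
    L2 n →L[ℂ] L2 n :=
  LinearMap.mkContinuous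
    { toFun := fun φ => ∫ v, h v • S.rep v φ ∂(lebesgue (horizontal 𝔤))
      map_add' := fun φ ψ => by
        simp only [map_add, smul_add]
        exact integral_add (S.integrable_smul_rep hh φ) (S.integrable_smul_rep hh ψ)
      map_smul' := fun c φ => by
        simp only [map_smul, RingHom.id_apply]
        rw [← integral_smul]
        simp only [smul_comm c] }
    (∫ v, ‖h v‖ ∂(lebesgue (horizontal 𝔤)))
    (fun φ => by
      refine (norm_integral_le_integral_norm _).trans (le_of_eq ?_)
      simp only [norm_smul, LinearIsometry.norm_map]
      exact integral_mul_const _ _)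

end AlmostSymplecticBasis

end Metivier

end

/-! ### Fourier uniqueness, entire functions, and orthogonality in finite dimension. -/

section

open scoped FourierTransform InnerProductSpace SchwartzMap

/-! Write W for the Weyl transform of h and π for π_ω. Conjugating W by π(p) multiplies h(v) by the
character exp(-iσ(p,v)), where σ is `symplecticForm`. Hence, for φ with bounded support, ⟨π(p)f,
Wπ(p)φ⟩ is the Fourier transform, in symplectic coordinates, of k(v) = h(v)⟨f, π(v)φ⟩. The aim is to
show that it vanishes for every p.

Along a line p = q + tY with Y = Y_1, the support of π(p)φ is translated by an amount linear in t,
and W enlarges supports by a bounded amount because h has bounded support. So the vectors Wπ(q +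
tY)φ are pairwise orthogonal for well separated t; as they lie in the finite-dimensional range of W,
they vanish for large t (`exists_forall_lt_eq_zero_of_inner_eq_zero`). The coefficient is the
restriction to real t of an entire function, again by bounded support, so it also vanishes at t = 0,
that is at p = q (`mul_inner_rep_ae_eq_zero`).

Since q is arbitrary and σ is non-degenerate, Fourier uniqueness gives k = 0 almost everywhere. With
f = π(v₀)φ and φ ≠ 0, strong continuity keeps ⟨f, π(v)φ⟩ non-zero near v₀, so h vanishes almost
everywhere near v₀. -/

/-- Uniqueness of the Fourier transform: an integrable function whose Fourier transform vanishes
identically vanishes almost everywhere. -/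
theorem MeasureTheory.Integrable.ae_eq_zero_of_fourier_eq_zero {E : Type*} [NormedAddCommGroup E]
    [InnerProductSpace ℝ E] [FiniteDimensional ℝ E] [MeasurableSpace E] [BorelSpace E] {f : E → ℂ}
    (hf : Integrable f) (h0 : ∀ w, 𝓕 f w = 0) : f =ᵐ[volume] 0 := by
  refine ae_eq_zero_of_integral_contDiff_smul_eq_zero hf.locallyIntegrable fun g hg hgc => ?_
  have hc : HasCompactSupport fun x => (g x : ℂ) := hgc.comp_left Complex.ofReal_zero
  set G : 𝓢(E, ℂ) := hc.toSchwartzMap (Complex.ofRealCLM.contDiff.comp hg) with hG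
  -- The Fourier transform moves across the integral: ∫ 𝓕f · 𝓕⁻G = ∫ f · 𝓕𝓕⁻G = ∫ f g, and the left
  -- side is zero.
  have key := VectorFourier.integral_fourierIntegral_smul_eq_flip (μ := (volume : Measure E))
    (ν := (volume : Measure E)) (L := innerₗ E) Real.continuous_fourierChar
    (by simpa using continuous_inner) hf (𝓕⁻ G : 𝓢(E, ℂ)).integrable
  have hl : ∀ w, VectorFourier.fourierIntegral Real.fourierChar volume (innerₗ E) f w = 0 := h0
  have hr : ∀ x, VectorFourier.fourierIntegral Real.fourierChar volume (innerₗ E).flip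
      (𝓕⁻ G : 𝓢(E, ℂ)) x = g x := fun x => by
    rw [flip_innerₗ]
    change 𝓕 (⇑(𝓕⁻ G : 𝓢(E, ℂ))) x = g x
    rw [← SchwartzMap.fourier_coe, FourierTransform.fourier_fourierInv_eq]
    rfl
  simp only [hl, hr, zero_smul, integral_zero] at key
  rw [key]
  simp [mul_comm]

/-- An exponential integral `∫ exp (-i z b) k` over a set on which `b` is bounded is an entire
function of `z`. -/
theorem MeasureTheory.Integrable.differentiable_integral_cexp_mul {α : Type*} [MeasurableSpace α]
    {μ : Measure α} {k : α → ℂ} (hk : Integrable k μ) {b : α → ℝ} (hb : AEStronglyMeasurable b μ)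
    {C : ℝ} (hC : ∀ᵐ v ∂μ, k v ≠ 0 → |b v| ≤ C) :
    Differentiable ℂ fun z : ℂ => ∫ v, Complex.exp (-(Complex.I * (z * b v))) * k v ∂μ := by
  intro z₀
  have hbC : AEStronglyMeasurable (fun v => (b v : ℂ)) μ :=
    Complex.continuous_ofReal.comp_aestronglyMeasurable hb
  have hexp : ∀ z : ℂ,
      AEStronglyMeasurable (fun v => Complex.exp (-(Complex.I * (z * b v)))) μ := fun z =>
    (show Continuous fun w : ℂ => Complex.exp (-(Complex.I * (z * w))) by
      fun_prop).comp_aestronglyMeasurable hbC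
  have hbound : ∀ (z : ℂ) (v : α), ‖z‖ ≤ ‖z₀‖ + 1 → |b v| ≤ C →
      ‖Complex.exp (-(Complex.I * (z * b v)))‖ ≤ Real.exp ((‖z₀‖ + 1) * C) := fun z v hz hv => by
    refine (Complex.norm_exp_le_exp_norm _).trans (Real.exp_le_exp.2 ?_)
    rw [norm_neg, norm_mul, norm_mul, Complex.norm_I, one_mul, Complex.norm_real, Real.norm_eq_abs]
    exact mul_le_mul hz hv (abs_nonneg _) (by positivity)
  have hball : ∀ z ∈ Metric.ball z₀ 1, ‖z‖ ≤ ‖z₀‖ + 1 := fun z hz => by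
    have h1 := norm_le_norm_add_norm_sub' z z₀
    have h2 : ‖z - z₀‖ < 1 := by simpa [dist_eq_norm] using hz
    linarith
  -- On the unit ball around `z₀`, wherever k ≠ 0, the exponential is at most exp((‖z₀‖ + 1)C) and
  -- differentiation in z costs a factor |b| ≤ C.
  refine ((hasDerivAt_integral_of_dominated_loc_of_deriv_le (𝕜 := ℂ) (μ := μ)
    (F := fun z v => Complex.exp (-(Complex.I * (z * b v))) * k v)
    (F' := fun z v => Complex.exp (-(Complex.I * (z * b v))) * -(Complex.I * b v) * k v)
    (bound := fun v => Real.exp ((‖z₀‖ + 1) * C) * C * ‖k v‖) (Metric.ball_mem_nhds z₀ one_pos)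
    ?_ ?_ ?_ ?_ ?_ ?_).2).differentiableAt
  · exact Eventually.of_forall fun z => (hexp z).mul hk.1
  · refine (hk.norm.const_mul (Real.exp ((‖z₀‖ + 1) * C))).mono' ((hexp z₀).mul hk.1) ?_
    filter_upwards [hC] with v hv
    rw [norm_mul]
    by_cases h0 : k v = 0
    · simp [h0]
    · exact mul_le_mul_of_nonneg_right (hbound z₀ v (by linarith) (hv h0)) (norm_nonneg _)
  · exact ((hexp z₀).mul (hbC.const_mul Complex.I).neg).mul hk.1
  · filter_upwards [hC] with v hv z hz
    by_cases h0 : k v = 0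
    · simp [h0]
    · rw [norm_mul, norm_mul]
      refine mul_le_mul_of_nonneg_right (mul_le_mul (hbound z v (hball z hz) (hv h0)) ?_
        (norm_nonneg _) (Real.exp_pos _).le) (norm_nonneg _)
      simpa using hv h0
  · exact hk.norm.const_mul _
  · refine ae_of_all _ fun v z _ => ?_
    have h1 : HasDerivAt (fun z : ℂ => -(Complex.I * (z * b v))) (-(Complex.I * b v)) z := by
      simpa using! (((hasDerivAt_id z).mul_const (b v : ℂ)).const_mul Complex.I).neg
    exact h1.cexp.mul_const _

/-- An entire function that vanishes on a right half-line of the real axis vanishes. -/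
theorem Differentiable.eq_zero_of_forall_lt_real {F : ℂ → ℂ} (hF : Differentiable ℂ F) {T : ℝ}
    (h0 : ∀ t : ℝ, T < t → F t = 0) : F = 0 := by
  have hA : AnalyticOnNhd ℂ F Set.univ := fun z _ => hF.analyticAt z
  refine hA.eq_of_frequently_eq (z₀ := ((T + 1 : ℝ) : ℂ)) (fun z _ => analyticAt_const) ?_
  have h1 : Tendsto (fun t : ℝ => (t : ℂ)) (𝓝[>] (T + 1)) (𝓝[≠] ((T + 1 : ℝ) : ℂ)) := by
    refine tendsto_nhdsWithin_iff.2 ⟨?_, ?_⟩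
    · exact (Complex.continuous_ofReal.tendsto _).mono_left nhdsWithin_le_nhds
    · filter_upwards [self_mem_nhdsWithin] with t ht
      exact fun h => ne_of_gt (Set.mem_Ioi.1 ht) (Complex.ofReal_injective h)
  refine h1.frequently (Eventually.frequently ?_)
  filter_upwards [self_mem_nhdsWithin] with t ht
  exact h0 t (by linarith [Set.mem_Ioi.1 ht])

/-- In a finite-dimensional subspace, a family indexed by the reals whose members are orthogonal as
soon as their parameters are at distance more than `L` vanishes for large parameters. -/
theorem exists_forall_lt_eq_zero_of_inner_eq_zero {H : Type*} [NormedAddCommGroup H]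
    [InnerProductSpace ℂ H] (V : Submodule ℂ H) [FiniteDimensional ℂ V] {u : ℝ → H}
    (hu : ∀ t, u t ∈ V) {L : ℝ} (hL : ∀ s t, L < t - s → ⟪u s, u t⟫_ℂ = 0) :
    ∃ T : ℝ, ∀ t, T < t → u t = 0 := by
  by_contra! hcon
  choose g hg hg0 using hcon
  -- Greedy choice: `g r` is a parameter beyond `r` at which `u` is non-zero. Gaps exceed `|L|`
  -- rather than `L`, so that the sequence increases even if `L` is negative. The values of `u`
  -- along it would form an infinite orthogonal family of non-zero vectors in `V`.
  let a : ℕ → ℝ := fun k => Nat.rec (g 0) (fun _ r => g (r + |L|)) k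
  have ha : ∀ k, a k + |L| < a (k + 1) := fun k => hg _
  have hmono : StrictMono a := strictMono_nat_of_lt_succ fun k => by
    linarith [ha k, abs_nonneg L]
  have hne : ∀ k, u (a k) ≠ 0 := fun k => by
    cases k with
    | zero => exact hg0 _
    | succ k => exact hg0 _
  have hlt : ∀ i j, i < j → ⟪u (a i), u (a j)⟫_ℂ = 0 := fun i j hij => by
    refine hL _ _ ?_
    linarith [ha i, hmono.monotone (Nat.succ_le_of_lt hij), le_abs_self L]
  have hli : LinearIndependent ℂ fun k => (⟨u (a k), hu _⟩ : V) := by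
    refine linearIndependent_of_ne_zero_of_inner_eq_zero (fun k h => hne k (congrArg Subtype.val h))
      fun i j hij => ?_
    rcases lt_or_gt_of_ne hij with h | h
    · exact hlt i j h
    · exact inner_eq_zero_symm.1 (hlt j i h)
  exact not_finite_iff_infinite.2 (inferInstance : Infinite ℕ) hli.finite

end
-- Supports, the symplectic form and the operators `π_ω(v)`.
section

open scoped FourierTransform InnerProductSpace

/-- Square-integrable functions supported in disjoint balls are orthogonal. -/
theorem MeasureTheory.L2.inner_eq_zero_of_support_in_balls {E : Type*} [NormedAddCommGroup E]
    [MeasurableSpace E] {μ : Measure E} {φ ψ : Lp ℂ 2 μ} {R : ℝ} {a b : E}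
    (hφ : ∀ᵐ ξ ∂μ, R < ‖ξ - a‖ → φ ξ = 0) (hψ : ∀ᵐ ξ ∂μ, R < ‖ξ - b‖ → ψ ξ = 0)
    (hab : 2 * R < ‖a - b‖) : ⟪φ, ψ⟫_ℂ = 0 := by
  rw [L2.inner_def]
  refine integral_eq_zero_of_ae ?_
  filter_upwards [hφ, hψ] with ξ h1 h2
  by_cases h : R < ‖ξ - a‖
  · simp [h1 h]
  · have h3 : ‖a - b‖ ≤ ‖ξ - a‖ + ‖ξ - b‖ := by
      have := norm_sub_le (ξ - b) (ξ - a)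
      rw [sub_sub_sub_cancel_left] at this
      linarith
    simp [h2 (by linarith [not_lt.1 h])]

namespace Metivier.AlmostSymplecticBasis

variable {𝔤 : Type*} [NormedLieRing 𝔤] [InnerProductLieAlgebra 𝔤] [IsStepTwo 𝔤]
  {ω : Module.Dual ℝ (centerSpace 𝔤)} {n : ℕ}

/-- A Lie algebra of step two is not abelian, so it has a non-zero horizontal space. -/
theorem ne_zero [FiniteDimensional ℝ 𝔤] (S : AlmostSymplecticBasis ω n) : n ≠ 0 := by
  rintro rfl
  have hbot : horizontal 𝔤 = ⊥ := by
    rw [Submodule.eq_bot_iff]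
    intro v hv
    have h1 : (⟨v, hv⟩ : horizontal 𝔤) = 0 :=
      S.basis.toBasis.repr.injective (Subsingleton.elim _ _)
    exact congrArg Subtype.val h1
  have htop : LieAlgebra.center ℝ 𝔤 = ⊤ := by
    rw [← LieSubmodule.toSubmodule_eq_top]
    exact Submodule.orthogonal_eq_bot_iff.1 hbot
  have hab : IsLieAbelian 𝔤 := (LieAlgebra.isLieAbelian_iff_center_eq_top ℝ 𝔤).2 htop
  have h2 := ((LieModule.nilpotencyLength_eq_succ_iff (R := ℝ) (L := 𝔤) (M := 𝔤) 1).1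
    (IsStepTwo.length_eq (𝔤 := 𝔤))).2
  exact h2 ((LieModule.trivial_iff_lower_central_eq_bot ℝ 𝔤 𝔤).1 hab)

variable (S : AlmostSymplecticBasis ω n)

/-- The bilinear form `B_ω` in the coordinates of an almost symplectic basis (up to sign). -/
noncomputable def symplecticForm (p v : horizontal 𝔤) : ℝ :=
  ∑ j, S.d j * (S.x v j * S.y p j - S.x p j * S.y v j)

theorem x_add_smul (q p : horizontal 𝔤) (t : ℝ) : S.x (q + t • p) = S.x q + t • S.x p := by
  ext j
  simp [x]

theorem y_add_smul (q p : horizontal 𝔤) (t : ℝ) : S.y (q + t • p) = S.y q + t • S.y p := by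
  ext j
  simp [y]

theorem symplecticForm_add_smul (q p v : horizontal 𝔤) (t : ℝ) :
    S.symplecticForm (q + t • p) v = S.symplecticForm q v + t * S.symplecticForm p v := by
  simp only [symplecticForm, x_add_smul, y_add_smul, PiLp.add_apply, PiLp.smul_apply, smul_eq_mul,
    Finset.mul_sum, ← Finset.sum_add_distrib]
  exact Finset.sum_congr rfl fun j _ => by ring

theorem continuous_symplecticForm (p : horizontal 𝔤) : Continuous (S.symplecticForm p) := by
  have hx : ∀ j, Continuous fun v => S.x v j := fun j =>
    (EuclideanSpace.proj (𝕜 := ℝ) j).continuous.comp S.continuous_x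
  have hy : ∀ j, Continuous fun v => S.y v j := fun j =>
    (EuclideanSpace.proj (𝕜 := ℝ) j).continuous.comp S.continuous_y
  unfold symplecticForm
  fun_prop

/-- Non-degeneracy, from d_j > 0: matching the coefficients of x_j(v) and y_j(v) forces y_j(p) =
x_j(w)/d_j and x_j(p) = -y_j(w)/d_j. It turns symplectic characters into ordinary Fourier
characters. -/
theorem exists_symplecticForm_eq_inner (w : horizontal 𝔤) :
    ∃ p, ∀ v, S.symplecticForm p v = ⟪w, v⟫_ℝ := by
  refine ⟨S.basis.repr.symm (WithLp.toLp 2 (Sum.elim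
    (fun j => -(S.y w j / S.d j)) (fun j => S.x w j / S.d j))), fun v => ?_⟩
  rw [← S.basis.repr.inner_map_map w v, PiLp.inner_apply, Fintype.sum_sum_type,
    ← Finset.sum_add_distrib]
  refine Finset.sum_congr rfl fun j _ => ?_
  have := (S.d_pos j).ne'
  simp [x, y]
  field_simp

theorem norm_cexp_symplecticForm (p v : horizontal 𝔤) :
    ‖Complex.exp (Complex.I * S.symplecticForm p v)‖ = 1 := by
  rw [mul_comm, Complex.norm_exp_ofReal_mul_I]

/-- The commutation relation of the operators `π_ω(v)`. -/
theorem rep_rep (p v : horizontal 𝔤) (φ : L2 n) :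
    S.rep p (S.rep v φ) =
      Complex.exp (Complex.I * S.symplecticForm p v) • S.rep v (S.rep p φ) := by
  apply Lp.ext
  filter_upwards [S.coeFn_rep p (S.rep v φ), S.repFun_congr p (S.coeFn_rep v φ),
    Lp.coeFn_smul (Complex.exp (Complex.I * S.symplecticForm p v)) (S.rep v (S.rep p φ)),
    S.coeFn_rep v (S.rep p φ), S.repFun_congr v (S.coeFn_rep p φ)] with ξ e1 e2 e3 e4 e5
  simp only [repFun] at e2 e5
  rw [e1, e2, e3, Pi.smul_apply, e4, e5, smul_eq_mul, ← mul_assoc, ← mul_assoc, ← mul_assoc,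
    add_right_comm ξ (S.y v) (S.y p)]
  congr 1
  unfold phase
  rw [← Complex.exp_add, ← Complex.exp_add, ← Complex.exp_add, ← mul_add, ← mul_add, ← mul_add]
  congr 2
  norm_cast
  simp only [symplecticForm, ← Finset.sum_add_distrib, PiLp.add_apply]
  exact Finset.sum_congr rfl fun j _ => by ring

/-- Commuting π(p) past π(v) and cancelling the isometry π(p) leaves only a scalar character. -/
theorem inner_rep_rep (p v : horizontal 𝔤) (f φ : L2 n) :
    ⟪S.rep p f, S.rep v (S.rep p φ)⟫_ℂ =
      Complex.exp (-(Complex.I * S.symplecticForm p v)) * ⟪f, S.rep v φ⟫_ℂ := by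
  rw [← (S.rep p).inner_map_map f, S.rep_rep p v, inner_smul_right, ← mul_assoc,
    ← Complex.exp_add, neg_add_cancel, Complex.exp_zero, one_mul]

theorem rep_support {φ : L2 n} {R : ℝ} {a : EuclideanSpace ℝ (Fin n)}
    (hφ : ∀ᵐ ξ, R < ‖ξ - a‖ → φ ξ = 0) (v : horizontal 𝔤) :
    ∀ᵐ ξ, R < ‖ξ - (a - S.y v)‖ → S.rep v φ ξ = 0 := by
  filter_upwards [S.coeFn_rep v φ,
    (S.measurePreserving_shift v).quasiMeasurePreserving.ae hφ] with ξ e1 e2 hξ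
  rw [e1, e2 (by rwa [show ξ + S.y v - a = ξ - (a - S.y v) by abel]), mul_zero]

theorem continuous_inner_rep (f φ : L2 n) : Continuous fun v => ⟪f, S.rep v φ⟫_ℂ :=
  continuous_const.inner (S.continuous_rep φ)

/-! ### Matrix coefficients of the Weyl transform and the finite rank argument. -/

variable [FiniteDimensional ℝ 𝔤] [MeasurableSpace 𝔤] [BorelSpace 𝔤]
  {h : horizontal 𝔤 → ℂ}

theorem integrable_mul_inner_rep (hh : Integrable h (lebesgue (horizontal 𝔤))) (f φ : L2 n) :
    Integrable (fun v => h v * ⟪f, S.rep v φ⟫_ℂ) (lebesgue (horizontal 𝔤)) := by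
  simpa [inner_smul_right] using (S.integrable_smul_rep hh φ).const_inner (𝕜 := ℂ) f

theorem inner_weylTransform (hh : Integrable h (lebesgue (horizontal 𝔤))) (f φ : L2 n) :
    ⟪f, S.weylTransform h hh φ⟫_ℂ =
      ∫ v, h v * ⟪f, S.rep v φ⟫_ℂ ∂(lebesgue (horizontal 𝔤)) := by
  simp only [← inner_smul_right]
  exact (integral_inner (S.integrable_smul_rep hh φ) f).symm

theorem inner_rep_weylTransform_rep (hh : Integrable h (lebesgue (horizontal 𝔤)))
    (p : horizontal 𝔤) (f φ : L2 n) :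
    ⟪S.rep p f, S.weylTransform h hh (S.rep p φ)⟫_ℂ =
      ∫ v, Complex.exp (-(Complex.I * S.symplecticForm p v)) * (h v * ⟪f, S.rep v φ⟫_ℂ)
        ∂(lebesgue (horizontal 𝔤)) := by
  rw [inner_weylTransform]
  refine integral_congr_ae (ae_of_all _ fun v => ?_)
  simp only [inner_rep_rep]
  ring

/-- If `f` is orthogonal to `π_ω(v) φ` for `v` in the essential support of `h`, then `f` is
orthogonal to `W_ω(h) φ`. -/
theorem inner_weylTransform_eq_zero (hh : Integrable h (lebesgue (horizontal 𝔤))) {f φ : L2 n}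
    (h0 : ∀ᵐ v ∂(lebesgue (horizontal 𝔤)), h v ≠ 0 → ⟪f, S.rep v φ⟫_ℂ = 0) :
    ⟪f, S.weylTransform h hh φ⟫_ℂ = 0 := by
  rw [inner_weylTransform]
  refine integral_eq_zero_of_ae ?_
  filter_upwards [h0] with v hv
  by_cases hv0 : h v = 0
  · simp [hv0]
  · simp [hv hv0]

/-- Two functions supported in balls far from each other have orthogonal images under the Weyl
transform of a function with bounded support. -/
theorem inner_weylTransform_weylTransform_eq_zero (hh : Integrable h (lebesgue (horizontal 𝔤)))
    {M : ℝ} (hM : ∀ᵐ v ∂(lebesgue (horizontal 𝔤)), h v ≠ 0 → ‖S.y v‖ ≤ M)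
    {φ ψ : L2 n} {R : ℝ} {a b : EuclideanSpace ℝ (Fin n)}
    (hφ : ∀ᵐ ξ, R < ‖ξ - a‖ → φ ξ = 0) (hψ : ∀ᵐ ξ, R < ‖ξ - b‖ → ψ ξ = 0)
    (hab : 2 * (R + M) < ‖a - b‖) :
    ⟪S.weylTransform h hh φ, S.weylTransform h hh ψ⟫_ℂ = 0 := by
  refine S.inner_weylTransform_eq_zero hh ?_
  filter_upwards [hM] with v hv hv0
  rw [inner_eq_zero_symm]
  refine S.inner_weylTransform_eq_zero hh ?_
  filter_upwards [hM] with v' hv' hv0'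
  refine L2.inner_eq_zero_of_support_in_balls (S.rep_support hψ v) (S.rep_support hφ v') ?_
  -- The two centres have moved by at most `M` each, so their distance still exceeds 2R.
  have h1 := norm_sub_le (b - S.y v - (a - S.y v') ) (S.y v' - S.y v)
  have h2 := norm_sub_le (S.y v') (S.y v)
  rw [show b - S.y v - (a - S.y v') - (S.y v' - S.y v) = -(a - b) by abel, norm_neg] at h1
  linarith [hv hv0, hv' hv0']

/-- If the Weyl transform of `h` has finite rank and `h` has bounded support, then the matrix
coefficients of a function `φ` with bounded support vanish on the support of `h`. -/
theorem mul_inner_rep_ae_eq_zero [NeZero n] (hh : Integrable h (lebesgue (horizontal 𝔤)))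
    {C : ℝ} (hC : ∀ᵐ v ∂(lebesgue (horizontal 𝔤)), h v ≠ 0 → ‖v‖ ≤ C)
    (hfin : FiniteDimensional ℂ (S.weylTransform h hh).range)
    {φ : L2 n} {R : ℝ} (hφ : ∀ᵐ ξ, R < ‖ξ - 0‖ → φ ξ = 0) (f : L2 n) :
    (fun v => h v * ⟪f, S.rep v φ⟫_ℂ) =ᵐ[lebesgue (horizontal 𝔤)] 0 := by
  have hbdd : ∀ {G : Type _} [SeminormedAddCommGroup G] (g : horizontal 𝔤 → G), Continuous g →
      ∃ M, ∀ v, ‖v‖ ≤ C → ‖g v‖ ≤ M := fun g hg => by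
    obtain ⟨M, hM⟩ := (isCompact_closedBall (0 : horizontal 𝔤) C).exists_bound_of_continuousOn
      hg.continuousOn
    exact ⟨M, fun v hv => hM v (by simpa using hv)⟩
  -- A unit direction that genuinely translates L²(η_ω); it exists because n ≠ 0.
  set Y : horizontal 𝔤 := S.basis (Sum.inr 0) with hY
  have hYy : ‖S.y Y‖ = 1 := by
    have : S.y Y = EuclideanSpace.single 0 1 := by
      ext j
      simp [y, hY]
    simp [this]
  obtain ⟨M, hM⟩ := hbdd S.y S.continuous_y
  have key : ∀ q, ∫ v, Complex.exp (-(Complex.I * S.symplecticForm q v)) *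
      (h v * ⟪f, S.rep v φ⟫_ℂ) ∂(lebesgue (horizontal 𝔤)) = 0 := fun q => by
    obtain ⟨T, hT⟩ := exists_forall_lt_eq_zero_of_inner_eq_zero (S.weylTransform h hh).range
      (u := fun t => S.weylTransform h hh (S.rep (q + t • Y) φ)) (L := 2 * (R + M))
      (fun t => ⟨_, rfl⟩) fun s t hst => by
        refine S.inner_weylTransform_weylTransform_eq_zero hh
          (hC.mono fun v hv hv0 => hM v (hv hv0)) (S.rep_support hφ _) (S.rep_support hφ _) ?_
        rw [y_add_smul, y_add_smul, show (0 : EuclideanSpace ℝ (Fin n)) - (S.y q + s • S.y Y) -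
          (0 - (S.y q + t • S.y Y)) = (t - s) • S.y Y by module, norm_smul, hYy, mul_one]
        exact hst.trans_le (le_abs_self _)
    obtain ⟨C', hC'⟩ := hbdd _ (S.continuous_symplecticForm Y)
    have hk : Integrable (fun v => Complex.exp (-(Complex.I * S.symplecticForm q v)) *
        (h v * ⟪f, S.rep v φ⟫_ℂ)) (lebesgue (horizontal 𝔤)) := by
      refine (S.integrable_mul_inner_rep hh f φ).bdd_mul (c := 1) ?_ (ae_of_all _ fun v => ?_)
      · have := S.continuous_symplecticForm q
        exact Continuous.aestronglyMeasurable (by fun_prop)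
      · rw [Complex.exp_neg, norm_inv, norm_cexp_symplecticForm, inv_one]
    have hD := hk.differentiable_integral_cexp_mul
      (S.continuous_symplecticForm Y).aestronglyMeasurable (C := C')
      (hC.mono fun v hv hv0 => hC' v (hv fun h0 => hv0 (by simp [h0])))
    -- The entire function vanishes for real t > T, hence identically; its value at 0 is the
    -- integral for `q` itself.
    have hz := congrFun (hD.eq_zero_of_forall_lt_real (T := T) fun t ht => ?_) 0
    · simpa using hz
    · have h1 := S.inner_rep_weylTransform_rep hh (q + t • Y) f φ
      rw [hT t ht, inner_zero_right] at h1
      rw [h1]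
      refine integral_congr_ae (ae_of_all _ fun v => ?_)
      simp only [symplecticForm_add_smul]
      rw [← mul_assoc, ← Complex.exp_add]
      push_cast
      ring_nf
  refine (S.integrable_mul_inner_rep hh f φ).ae_eq_zero_of_fourier_eq_zero fun w => ?_
  -- The factor 2π matches the kernel exp(-2πi⟨v, w⟩) of `𝓕`.
  obtain ⟨p, hp⟩ := S.exists_symplecticForm_eq_inner ((2 * Real.pi) • w)
  rw [← key p, Real.fourier_eq']
  refine integral_congr_ae (ae_of_all _ fun v => ?_)
  simp only [hp, smul_eq_mul, real_inner_smul_left, real_inner_comm w v]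
  congr 2
  push_cast
  ring

/-- A function with bounded support whose Weyl transform has finite rank vanishes. -/
theorem ae_eq_zero_of_finiteDimensional_range [NeZero n]
    (hh : Integrable h (lebesgue (horizontal 𝔤)))
    {C : ℝ} (hC : ∀ᵐ v ∂(lebesgue (horizontal 𝔤)), h v ≠ 0 → ‖v‖ ≤ C)
    (hfin : FiniteDimensional ℂ (S.weylTransform h hh).range) :
    h =ᵐ[lebesgue (horizontal 𝔤)] 0 := by
  -- Any non-zero φ with bounded support would do.
  set φ : L2 n := indicatorConstLp 2 (measurableSet_ball (x := 0) (ε := 1))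
    measure_ball_lt_top.ne (1 : ℂ) with hφdef
  have hφ0 : φ ≠ 0 := by
    rw [ne_eq, ← norm_eq_zero, hφdef, norm_indicatorConstLp (by simp) (by simp)]
    have := Metric.measure_ball_pos volume (0 : EuclideanSpace ℝ (Fin n)) one_pos
    have h2 : 0 < volume.real (Metric.ball (0 : EuclideanSpace ℝ (Fin n)) 1) :=
      ENNReal.toReal_pos this.ne' measure_ball_lt_top.ne
    simpa using h2.ne'
  have hφ : ∀ᵐ ξ, 1 < ‖ξ - 0‖ → φ ξ = 0 := by
    filter_upwards [indicatorConstLp_coeFn_notMem (p := 2) (hs := measurableSet_ball (x :=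
      (0 : EuclideanSpace ℝ (Fin n))) (ε := 1)) (hμs := measure_ball_lt_top.ne) (c := (1 : ℂ))]
      with ξ hξ h1
    refine hξ ?_
    rw [sub_zero] at h1
    simpa using h1.le
  refine measure_null_of_locally_null _ fun v₀ _ => ?_
  have hcont := S.continuous_inner_rep (S.rep v₀ φ) φ
  -- At v = v₀ the coefficient is ‖φ‖², so by continuity it is non-zero on a neighbourhood of `v₀`.
  have hne : ⟪S.rep v₀ φ, S.rep v₀ φ⟫_ℂ ≠ 0 := by
    rw [inner_self_ne_zero, ← norm_ne_zero_iff, LinearIsometry.norm_map]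
    exact norm_ne_zero_iff.2 hφ0
  have hae := S.mul_inner_rep_ae_eq_zero hh hC hfin hφ (S.rep v₀ φ)
  refine ⟨_, inter_mem_nhdsWithin _ (hcont.continuousAt.eventually_ne hne), ?_⟩
  refine measure_mono_null ?_ hae
  rintro v ⟨hv, hv1⟩ hv2
  exact (mul_eq_zero.1 hv2).elim hv hv1

end Metivier.AlmostSymplecticBasis

end

theorem proposition5p5 {𝔤 : Type*} [NormedLieRing 𝔤] [InnerProductLieAlgebra 𝔤]
    [FiniteDimensional ℝ 𝔤] [MeasurableSpace 𝔤] [BorelSpace 𝔤] [IsStepTwo 𝔤]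
    (hG : Metivier.IsMetivier 𝔤)
    (ω : Module.Dual ℝ (Metivier.centerSpace 𝔤)) (hω : ω ∈ Metivier.maximalSet 𝔤)
    {n : ℕ} (S : Metivier.AlmostSymplecticBasis ω n)
    (h : Metivier.horizontal 𝔤 → ℂ)
    (h1 : Integrable h (lebesgue (Metivier.horizontal 𝔤)))
    (h2 : MemLp h 2 (lebesgue (Metivier.horizontal 𝔤)))
    (K : Set (Metivier.horizontal 𝔤)) (hK : IsCompact K)
    (hsupp : ∀ᵐ v ∂(lebesgue (Metivier.horizontal 𝔤)), v ∉ K → h v = 0)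
    (hfin : FiniteDimensional ℂ (S.weylTransform h h1).range) :
    h =ᵐ[lebesgue (Metivier.horizontal 𝔤)] 0 := by
  have : NeZero n := ⟨S.ne_zero⟩
  obtain ⟨C, hC⟩ := hK.isBounded.exists_norm_le
  exact S.ae_eq_zero_of_finiteDimensional_range h1
    (hsupp.mono fun v hv hv0 => hC v (by_contra fun hvK => hv0 (hv hvK))) hfin
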